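/- Let $G$ be a compact Hausdorff topological group with its normalised (regular) Haar measure $\lambda$, and let $K$ be a compact subgroup of $G$ such that $(G,K)$ is a Gelfand pair, i.e. the continuous $K$-bi-invariant functions $\varphi: G\to\mathbb{C}$ (those with $\varphi(kxk')=\varphi(x)$ for all $x\in G$, $k,k'\in K$) commute under the convolution $(\varphi*\psi)(x)=\int_G \varphi(y)\psi(y^{-1}x)\,d\lambda(y)$. Let $f: G\to\mathbb{R}$ be continuous, $K$-bi-invariant and positive definite, i.e. $\sum_{i,j=1}^n c_i\overline{c_j} f(x_i^{-1}x_j)\ge 0$ for all $n\in\mathbb{N}$, $c_1,\dots,c_n\in\mathbb{C}$ and $x_1,\dots,x_n\in G$. Then there is a $K$-bi-invariant function $g: G\to\mathbb{C}$ in $L^2(G)$ that is positive definite in the integral sense, $$\int_G\int_G g(y^{-1}x)\,\varphi(x)\,\overline{\varphi(y)}\,d\lambda(x)\,d\lambda(y)\ge 0\qquad\text{for all continuous } \varphi: G\to\mathbb{C},$$ such that for every $x\in G$ the integral defining $(g*g)(x)$ converges absolutely and $f(x)=(g*g)(x)$. -/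

import Mathlib

open MeasureTheory

namespace GelfandRoot

noncomputable section

open scoped ComplexOrder ComplexConjugate

variable {G : Type*} [Group G]

/-- `φ (k g k') = φ g` for all `g ∈ G` and `k, k' ∈ K`. -/
def IsBiInvariant {E : Type*} (K : Subgroup G) (φ : G → E) : Prop :=
  ∀ k ∈ K, ∀ k' ∈ K, ∀ g : G, φ (k * g * k') = φ g

/-- Pointwise positive definiteness; `0 ≤ z` for complex `z` means that `z` is real and
nonnegative. -/
def IsPosDef (f : G → ℂ) : Prop :=
  ∀ (n : ℕ) (c : Fin n → ℂ) (g : Fin n → G),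
    0 ≤ ∑ i, ∑ j, c i * conj (c j) * f ((g i)⁻¹ * g j)

/-- The convolution `(f ∗ g) x = ∫ f y * g (y⁻¹ x) dμ y` exists at `x`. -/
def ConvExistsAt [MeasurableSpace G] (μ : Measure G) (f g : G → ℂ) (x : G) : Prop :=
  Integrable (fun y => f y * g (y⁻¹ * x)) μ

/-- The convolution `(f ∗ g) x = ∫ f y * g (y⁻¹ x) dμ y`. -/
def conv [MeasurableSpace G] (μ : Measure G) (f g : G → ℂ) (x : G) : ℂ :=
  ∫ y, f y * g (y⁻¹ * x) ∂μ

/-- Positive definiteness of a function that is determined only almost everywhere (meant for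
locally integrable functions, in particular for functions in `L²` of a compact group): the
Hermitian form `∫ ∫ f (y⁻¹ x) φ x conj (φ y) dx dy` is nonnegative on `C_c(G)`. -/
def IsIntegrallyPosDef [TopologicalSpace G] [MeasurableSpace G] (μ : Measure G)
    (f : G → ℂ) : Prop :=
  ∀ φ : G → ℂ, Continuous φ → HasCompactSupport φ →
    0 ≤ ∫ y, ∫ x, f (y⁻¹ * x) * φ x * conj (φ y) ∂μ ∂μ

/-- `(G, K)` is a Gelfand pair: `K` is a compact subgroup of `G`, and the continuous, compactly
supported, `K`-bi-invariant complex functions commute under convolution. -/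
structure IsGelfandPair [TopologicalSpace G] [MeasurableSpace G] (μ : Measure G)
    (K : Subgroup G) : Prop where
  isCompact : IsCompact (K : Set G)
  conv_comm : ∀ φ ψ : G → ℂ,
    Continuous φ → HasCompactSupport φ → IsBiInvariant K φ →
    Continuous ψ → HasCompactSupport ψ → IsBiInvariant K ψ →
    conv μ φ ψ = conv μ ψ φ

end

end GelfandRoot

open scoped ComplexOrder ComplexConjugate

/-! After scaling, `‖f‖ ≤ 1`. Right convolution by `f` is then a positive contraction `T` on
`L²(G)`, and the required `g` is the function whose convolution operator is `√T`. To obtain a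
function and not just an operator, `√T` is approached by polynomials `p n` in `T` without constant
term, which are convolutions by continuous functions `g n`.

The key is that evaluation at the identity behaves like a trace: if convolution by a continuous `h`
is a positive operator, then `0 ≤ (h 1).re` (`re_apply_one_nonneg_of_convL2_nonneg`), while `(h ∗ h)
1 = ‖h‖₂²` for Hermitian `h`. Polynomial inequalities on `[0, 1]` thus become `L²` estimates: `(g n
∗ g n) 1` is increasing and bounded by `f 1`, and its increments dominate `‖g m - g n‖₂²`. So `g n`
converges in `L²` to some `g`, and `g n ∗ g n` converges to `g ∗ g` uniformly by Cauchy-Schwarz. The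
recursion makes `f - g n ∗ g n` tend to `0` in `L²`. Hence `f = g ∗ g`, everywhere because both
sides are continuous. -/

namespace GelfandRoot

noncomputable section

set_option linter.unusedSectionVars false

/-! ### Invariance of Haar measure on a compact group -/

section Haar

variable {G : Type*} [Group G] [TopologicalSpace G] [IsTopologicalGroup G] [CompactSpace G]
  [MeasurableSpace G] [BorelSpace G] (μ : Measure G) [μ.IsHaarMeasure] [IsProbabilityMeasure μ]

/-- The Haar probability measure of a compact group is right invariant. -/
lemma isMulRightInvariant_of_compactSpace : μ.IsMulRightInvariant := by
  refine ⟨fun x => ?_⟩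
  have : IsProbabilityMeasure (μ.map (· * x)) :=
    Measure.isProbabilityMeasure_map (continuous_mul_const x).aemeasurable
  have : (μ.map (· * x)).IsHaarMeasure := Measure.isHaarMeasure_map_mul_right μ x
  exact Measure.isHaarMeasure_eq_of_isProbabilityMeasure _ _

/-- The Haar probability measure of a compact group is invariant under inversion. -/
lemma isInvInvariant_of_compactSpace : μ.IsInvInvariant := by
  have := isMulRightInvariant_of_compactSpace μ
  refine ⟨?_⟩
  have : IsProbabilityMeasure μ.inv :=
    Measure.isProbabilityMeasure_map continuous_inv.aemeasurable
  have : μ.inv.IsHaarMeasure := {}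
  exact Measure.isHaarMeasure_eq_of_isProbabilityMeasure _ _

lemma measurePreserving_inv_mul_const (x : G) : MeasurePreserving (fun y => y⁻¹ * x) μ μ := by
  have := isMulRightInvariant_of_compactSpace μ
  have := isInvInvariant_of_compactSpace μ
  exact (measurePreserving_mul_right μ x).comp (Measure.measurePreserving_inv μ)

end Haar

/-! ### Positive kernels: from finite sums to integrals -/

section Integral

variable {X : Type*} [TopologicalSpace X] [CompactSpace X] [LocallyCompactSpace X]
  [MeasurableSpace X] [BorelSpace X]
  (μ : Measure X) [IsProbabilityMeasure μ]

lemma integral_integral_swap_of_continuous {F : X → X → ℂ} (hF : Continuous F.uncurry) :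
    ∫ x, ∫ y, F x y ∂μ ∂μ = ∫ y, ∫ x, F x y ∂μ ∂μ :=
  integral_integral_swap_of_hasCompactSupport hF (HasCompactSupport.of_compactSpace _)

/-- A continuous Hermitian kernel that is nonnegative on finite convex combinations of point masses
is nonnegative on a probability measure. -/
lemma integral_integral_nonneg_of_sum (F : C(X, C(X, ℂ)))
    (hsymm : ∀ x y, F y x = conj (F x y))
    (hF : ∀ (ι : Type) (s : Finset ι) (w : ι → ℝ) (x : ι → X),
      0 ≤ ∑ i ∈ s, ∑ j ∈ s, (w i : ℂ) * w j * F (x i) (x j)) :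
    0 ≤ ∫ x, ∫ y, F x y ∂μ ∂μ := by
  have hswap : conj (∫ x, ∫ y, F x y ∂μ ∂μ) = ∫ x, ∫ y, F x y ∂μ ∂μ := by
    rw [← integral_conj]
    simp only [← integral_conj, ← hsymm]
    exact integral_integral_swap_of_continuous μ (F := fun x y => F y x)
      (F.continuous_uncurry_of_continuous.comp continuous_swap)
  rw [Complex.le_def]
  refine ⟨?_, (Complex.conj_eq_iff_im.1 hswap).symm⟩
  rw [Complex.zero_re]
  have hFi : Integrable F μ :=
    F.continuous.integrable_of_hasCompactSupport (HasCompactSupport.of_compactSpace _)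
  -- The mean of `x ↦ F x` is a uniform limit of finite convex combinations of its values, so one
  -- weighted point set discretises both integrals.
  have hmem : ∫ x, F x ∂μ ∈ closure (convexHull ℝ (Set.range F)) :=
    (convex_convexHull ℝ _).closure.integral_mem isClosed_closure
      (.of_forall fun x => subset_closure (subset_convexHull ℝ _ ⟨x, rfl⟩)) hFi
  have hev : ∀ y, (∫ x, F x ∂μ) y = ∫ x, F x y ∂μ := fun y =>
    ContinuousMap.integral_apply hFi y
  have hI : ∀ u : C(X, ℂ), Integrable u μ := fun u =>
    u.continuous.integrable_of_hasCompactSupport (HasCompactSupport.of_compactSpace _)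
  have := nonempty_of_isProbabilityMeasure μ
  refine le_of_forall_pos_lt_add fun ε hε => ?_
  -- The error `‖V - v‖` is paid twice, once for each variable (`h2` and `h4`).
  obtain ⟨v, hv, hdist⟩ := Metric.mem_closure_iff.1 hmem (ε / 2) (by positivity)
  rw [convexHull_eq] at hv
  obtain ⟨ι, s, w, z, hw0, hw1, hz, rfl⟩ := hv
  choose! p hp using hz
  have hv : s.centerMass w z = ∑ i ∈ s, w i • F (p i) := by
    rw [Finset.centerMass_eq_of_sum_1 _ _ hw1]
    exact Finset.sum_congr rfl fun i hi => by rw [hp i hi]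
  rw [hv, dist_eq_norm] at hdist
  set v : C(X, ℂ) := ∑ i ∈ s, w i • F (p i) with hvdef
  set V : C(X, ℂ) := ∫ x, F x ∂μ with hV
  have hb : ∀ y, ‖V y - v y‖ ≤ ‖V - v‖ := fun y => (V - v).norm_coe_le_norm y
  have hvy : ∀ y, v y = ∑ i ∈ s, (w i : ℂ) * F (p i) y := fun y => by
    simp [hvdef, ContinuousMap.sum_apply]
  -- the total mass of `V` is the double integral up to conjugation
  have h1 : ∫ x, ∫ y, F x y ∂μ ∂μ = conj (∫ y, V y ∂μ) := by
    rw [← integral_conj]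
    refine integral_congr_ae (.of_forall fun x => ?_)
    simp only [hev]
    rw [← integral_conj]
    simp only [← hsymm]
  have h2 : ‖∫ y, V y ∂μ - ∫ y, v y ∂μ‖ ≤ ‖V - v‖ := by
    rw [← integral_sub (hI V) (hI v)]
    simpa using norm_integral_le_of_norm_le_const (μ := μ) (.of_forall hb)
  have h3 : ∫ y, v y ∂μ = ∑ i ∈ s, (w i : ℂ) * conj (V (p i)) := by
    simp only [hvy]
    rw [integral_finsetSum _ fun i _ => (hI (F (p i))).const_mul _]
    refine Finset.sum_congr rfl fun i _ => ?_
    rw [integral_const_mul, hev, ← integral_conj]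
    simp only [← hsymm]
  have h4 : ‖∑ i ∈ s, (w i : ℂ) * conj (V (p i)) - ∑ i ∈ s, (w i : ℂ) * conj (v (p i))‖
      ≤ ‖V - v‖ := by
    rw [← Finset.sum_sub_distrib]
    calc _ ≤ ∑ i ∈ s, w i * ‖V - v‖ := norm_sum_le_of_le _ fun i hi => by
            rw [← mul_sub, ← map_sub, norm_mul, RCLike.norm_conj, Complex.norm_real,
              Real.norm_of_nonneg (hw0 i hi)]
            exact mul_le_mul_of_nonneg_left (hb _) (hw0 i hi)
      _ = ‖V - v‖ := by rw [← Finset.sum_mul, hw1, one_mul]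
  have h5 : ∑ i ∈ s, (w i : ℂ) * conj (v (p i)) =
      ∑ i ∈ s, ∑ j ∈ s, (w i : ℂ) * w j * F (p i) (p j) := by
    refine Finset.sum_congr rfl fun i _ => ?_
    rw [hvy, map_sum, Finset.mul_sum]
    refine Finset.sum_congr rfl fun j _ => ?_
    rw [map_mul, ← hsymm, Complex.conj_ofReal, mul_assoc]
  have h6 := (Complex.le_def.1 (hF ι s w p)).1
  rw [← h5, Complex.zero_re] at h6
  have h7 := (Complex.abs_re_le_norm _).trans h2
  have h8 := (Complex.abs_re_le_norm _).trans h4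
  rw [← h3, Complex.sub_re] at h8
  rw [Complex.sub_re] at h7
  rw [h1, Complex.conj_re]
  rw [abs_le] at h7 h8
  linarith [h7.1, h8.1]

end Integral

/-! ### Convolution operators on `L²` -/

section ConvOp

variable {G : Type*} [Group G] [TopologicalSpace G] [IsTopologicalGroup G] [CompactSpace G]
  [MeasurableSpace G] [BorelSpace G] (μ : Measure G) [IsProbabilityMeasure μ]

/-- The continuous function `x ↦ (y ↦ h (y⁻¹ x))`. -/
def translates (h : C(G, ℂ)) : C(G, C(G, ℂ)) :=
  (h.comp ⟨fun p : G × G => p.2⁻¹ * p.1, by fun_prop⟩).curry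

@[simp]
lemma translates_apply (h : C(G, ℂ)) (x y : G) : translates h x y = h (y⁻¹ * x) := rfl

/-- The conjugate of `y ↦ h (y⁻¹ x)` as a vector of `L²`. -/
def kernelVec (h : C(G, ℂ)) (x : G) : Lp ℂ 2 μ :=
  ContinuousMap.toLp 2 μ ℂ (star (translates h x))

lemma continuous_kernelVec (h : C(G, ℂ)) : Continuous (kernelVec μ h) :=
  (ContinuousMap.toLp 2 μ ℂ).continuous.comp (continuous_star.comp (translates h).continuous)

lemma norm_toLp_le (h : C(G, ℂ)) : ‖ContinuousMap.toLp 2 μ ℂ h‖ ≤ ‖h‖ := by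
  have := Lp.norm_le_of_ae_bound (f := ContinuousMap.toLp 2 μ ℂ h) (norm_nonneg h) (by
    filter_upwards [ContinuousMap.coeFn_toLp (p := 2) (𝕜 := ℂ) μ h] with x hx
    rw [hx]
    exact h.norm_coe_le_norm x)
  simpa [measureUnivNNReal] using this

lemma norm_kernelVec_le (h : C(G, ℂ)) (x : G) : ‖kernelVec μ h x‖ ≤ ‖h‖ := by
  refine (norm_toLp_le μ _).trans ?_
  rw [norm_star]
  exact (ContinuousMap.norm_le _ (norm_nonneg _)).2 fun y => h.norm_coe_le_norm _

/-- Right convolution `φ ↦ φ ∗ h` by a continuous function, from `L²` to continuous functions. -/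
def convOp (h : C(G, ℂ)) : Lp ℂ 2 μ →L[ℂ] C(G, ℂ) :=
  LinearMap.mkContinuous
    { toFun := fun φ => ⟨fun x => inner ℂ (kernelVec μ h x) φ,
        (continuous_kernelVec μ h).inner continuous_const⟩
      map_add' := fun φ ψ => by ext x; simp [inner_add_right]
      map_smul' := fun c φ => by ext x; simp [inner_smul_right] }
    ‖h‖ fun φ => (ContinuousMap.norm_le _ (by positivity)).2 fun x =>
      (norm_inner_le_norm _ _).trans
        (mul_le_mul_of_nonneg_right (norm_kernelVec_le μ h x) (norm_nonneg _))

lemma convOp_apply (h : C(G, ℂ)) (φ : Lp ℂ 2 μ) (x : G) :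
    convOp μ h φ x = inner ℂ (kernelVec μ h x) φ := rfl

lemma convOp_apply_eq_conv (h : C(G, ℂ)) (φ : Lp ℂ 2 μ) (x : G) :
    convOp μ h φ x = conv μ φ h x := by
  rw [convOp_apply, L2.inner_def, conv]
  refine integral_congr_ae ?_
  filter_upwards [ContinuousMap.coeFn_toLp (p := 2) (𝕜 := ℂ) μ (star (translates h x))] with y hy
  rw [kernelVec, hy]
  simp

/-- Convolution of continuous functions. -/
def convC (h k : C(G, ℂ)) : C(G, ℂ) := convOp μ k (ContinuousMap.toLp 2 μ ℂ h)

lemma convC_apply (h k : C(G, ℂ)) (x : G) : convC μ h k x = conv μ h k x := by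
  rw [convC, convOp_apply_eq_conv, conv, conv]
  refine integral_congr_ae ?_
  filter_upwards [ContinuousMap.coeFn_toLp (p := 2) (𝕜 := ℂ) μ h] with y hy
  rw [hy]

lemma norm_convOp_le (h : C(G, ℂ)) : ‖convOp μ h‖ ≤ ‖h‖ :=
  LinearMap.mkContinuous_norm_le _ (norm_nonneg _) _

/-- Right convolution `φ ↦ φ ∗ h` by a continuous function as an operator on `L²`. -/
def convL2 (h : C(G, ℂ)) : Lp ℂ 2 μ →L[ℂ] Lp ℂ 2 μ :=
  (ContinuousMap.toLp 2 μ ℂ).comp (convOp μ h)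

lemma convL2_apply (h : C(G, ℂ)) (φ : Lp ℂ 2 μ) :
    convL2 μ h φ = ContinuousMap.toLp 2 μ ℂ (convOp μ h φ) := rfl

lemma convL2_toLp (h k : C(G, ℂ)) :
    convL2 μ k (ContinuousMap.toLp 2 μ ℂ h) = ContinuousMap.toLp 2 μ ℂ (convC μ h k) := rfl

lemma norm_convL2_le (h : C(G, ℂ)) : ‖convL2 μ h‖ ≤ ‖h‖ :=
  ContinuousLinearMap.opNorm_le_bound _ (norm_nonneg _) fun φ =>
    (norm_toLp_le μ _).trans ((convOp μ h).le_of_opNorm_le (norm_convOp_le μ h) φ)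

lemma convL2_add (h k : C(G, ℂ)) : convL2 μ (h + k) = convL2 μ h + convL2 μ k := by
  ext1 φ
  simp only [convL2_apply, add_apply, ← map_add]
  congr 1
  ext x
  have : star (translates (h + k) x) = star (translates h x) + star (translates k x) := by
    ext y; simp
  simp [convOp_apply, kernelVec, this, inner_add_left]

lemma convL2_smul (c : ℂ) (h : C(G, ℂ)) : convL2 μ (c • h) = c • convL2 μ h := by
  ext1 φ
  simp only [convL2_apply, smul_apply, ← map_smul]
  congr 1
  ext x
  have : star (translates (c • h) x) = conj c • star (translates h x) := by
    ext y; simp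
  simp [convOp_apply, kernelVec, this, inner_smul_left]

lemma convL2_sub (h k : C(G, ℂ)) : convL2 μ (h - k) = convL2 μ h - convL2 μ k := by
  rw [sub_eq_add_neg, ← neg_one_smul ℂ k, convL2_add, convL2_smul, neg_one_smul, sub_eq_add_neg]

lemma convL2_zero : convL2 μ (0 : C(G, ℂ)) = 0 := by
  simpa using convL2_smul μ 0 (0 : C(G, ℂ))

lemma inner_toLp_convL2_toLp (h ψ : C(G, ℂ)) :
    inner ℂ (ContinuousMap.toLp 2 μ ℂ ψ) (convL2 μ h (ContinuousMap.toLp 2 μ ℂ ψ)) =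
      ∫ x, ∫ y, ψ y * conj (ψ x) * h (y⁻¹ * x) ∂μ ∂μ := by
  rw [convL2_toLp, ContinuousMap.inner_toLp]
  refine integral_congr_ae (.of_forall fun x => ?_)
  simp only [convC_apply, conv]
  rw [← integral_mul_const]
  refine integral_congr_ae (.of_forall fun y => ?_)
  simp only
  ring

lemma convC_assoc [μ.IsMulLeftInvariant] (a h k : C(G, ℂ)) :
    convC μ (convC μ a h) k = convC μ a (convC μ h k) := by
  ext x
  simp only [convC_apply, conv]
  calc ∫ z, (∫ y, a y * h (y⁻¹ * z) ∂μ) * k (z⁻¹ * x) ∂μ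
      = ∫ z, ∫ y, a y * h (y⁻¹ * z) * k (z⁻¹ * x) ∂μ ∂μ := by
        simp only [integral_mul_const]
    _ = ∫ y, ∫ z, a y * h (y⁻¹ * z) * k (z⁻¹ * x) ∂μ ∂μ :=
        integral_integral_swap_of_continuous μ (by
          simp only [Function.uncurry_def]; fun_prop)
    _ = ∫ y, a y * ∫ z, h z * k (z⁻¹ * (y⁻¹ * x)) ∂μ ∂μ := by
        refine integral_congr_ae (.of_forall fun y => ?_)
        simp only [mul_assoc]
        rw [integral_const_mul, ← integral_mul_left_eq_self _ y]
        simp [mul_assoc]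

/-- Associativity on the dense subspace of continuous functions. The order reverses because the
operators convolve on the right. -/
lemma convL2_convC [μ.IsMulLeftInvariant] [μ.WeaklyRegular] [T2Space G] (h k : C(G, ℂ)) :
    convL2 μ (convC μ h k) = convL2 μ k * convL2 μ h := by
  refine ContinuousLinearMap.coeFn_injective ?_
  refine (ContinuousMap.toLp_denseRange ℂ μ ℂ (p := 2) (by simp)).equalizer
    (convL2 μ _).continuous (convL2 μ k * convL2 μ h).continuous ?_
  ext1 a
  simp [convL2_toLp, convC_assoc]

end ConvOp

/-! ### Pointwise positive definite functions -/

section PosDef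

variable {G : Type*} [Group G]

/-- A real positive definite function is symmetric. -/
lemma IsPosDef.apply_inv_of_real {f : G → ℝ} (hf : IsPosDef fun x => (f x : ℂ)) (x : G) :
    f x⁻¹ = f x := by
  -- With these coefficients the sum has imaginary part `f x⁻¹ - f x`, which must vanish.
  have h := hf 2 ![1, Complex.I] ![1, x]
  simp only [Fin.sum_univ_two, Complex.le_def] at h
  have := h.2
  simp at this
  linarith

lemma IsPosDef.sum_finset_nonneg {f : G → ℂ} (hf : IsPosDef f) {ι : Type*} (s : Finset ι)
    (c : ι → ℂ) (x : ι → G) :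
    0 ≤ ∑ i ∈ s, ∑ j ∈ s, c i * conj (c j) * f ((x i)⁻¹ * x j) := by
  have h := hf s.card (fun i => c (s.equivFin.symm i)) (fun i => x (s.equivFin.symm i))
  convert h using 1
  rw [← Finset.sum_coe_sort s, ← s.equivFin.symm.sum_comp]
  refine Finset.sum_congr rfl fun i _ => ?_
  rw [← Finset.sum_coe_sort s, ← s.equivFin.symm.sum_comp]

end PosDef

/-! ### Positivity of convolution operators -/

section Positivity

variable {G : Type*} [Group G] [TopologicalSpace G] [IsTopologicalGroup G] [CompactSpace G]
  [T2Space G] [MeasurableSpace G] [BorelSpace G] (μ : Measure G) [IsProbabilityMeasure μ]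

/-- Convolution by a continuous positive definite function is a positive operator on `L²`. -/
lemma convL2_nonneg_of_isPosDef [μ.WeaklyRegular] (h : C(G, ℂ)) (hpd : IsPosDef h)
    (hsymm : ∀ x, h x⁻¹ = conj (h x)) : 0 ≤ convL2 μ h := by
  have key : ∀ φ : Lp ℂ 2 μ, 0 ≤ inner ℂ φ (convL2 μ h φ) := by
    intro φ
    have hcl : IsClosed {φ : Lp ℂ 2 μ | 0 ≤ inner ℂ φ (convL2 μ h φ)} :=
      isClosed_le continuous_const (continuous_id.inner (convL2 μ h).continuous)
    refine (ContinuousMap.toLp_denseRange ℂ μ ℂ (p := 2) (by simp)).induction_on φ hcl ?_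
    intro ψ
    rw [inner_toLp_convL2_toLp]
    let F : C(G, C(G, ℂ)) := ContinuousMap.curry
      ⟨fun p : G × G => ψ p.2 * conj (ψ p.1) * h (p.2⁻¹ * p.1), by fun_prop⟩
    have hFa : ∀ x y, F x y = ψ y * conj (ψ x) * h (y⁻¹ * x) := fun _ _ => rfl
    refine integral_integral_nonneg_of_sum μ F (fun x y => ?_) fun ι s w x => ?_
    · have := hsymm (y⁻¹ * x)
      rw [mul_inv_rev, inv_inv] at this
      rw [hFa, hFa, this]
      simp only [map_mul, Complex.conj_conj]
      ring
    · have := hpd.sum_finset_nonneg s (fun i => (w i : ℂ) * ψ (x i)) x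
      -- The kernel has `y⁻¹ * x` where positive definiteness has `(x i)⁻¹ * x j`, so the two
      -- indices trade places.
      rw [Finset.sum_comm] at this
      convert this using 1
      refine Finset.sum_congr rfl fun i _ => Finset.sum_congr rfl fun j _ => ?_
      rw [hFa]
      simp only [map_mul, Complex.conj_ofReal]
      ring
  rw [ContinuousLinearMap.nonneg_iff_isPositive, ContinuousLinearMap.isPositive_iff_complex]
  intro φ
  have h1 := Complex.le_def.1 (key φ)
  have h2 : inner ℂ (convL2 μ h φ) φ = inner ℂ φ (convL2 μ h φ) := by
    rw [← inner_conj_symm]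
    exact Complex.conj_eq_iff_im.2 h1.2.symm
  rw [h2]
  exact ⟨Complex.ext rfl h1.2, h1.1⟩

/-- If convolution by a continuous function is a positive operator, then the function has
nonnegative real part at the identity. -/
lemma re_apply_one_nonneg_of_convL2_nonneg [μ.IsOpenPosMeasure] (h : C(G, ℂ))
    (hpos : 0 ≤ convL2 μ h) : 0 ≤ (h 1).re := by
  by_contra! hneg
  obtain ⟨δ, hδ, hδ'⟩ : ∃ δ > 0, (h 1).re < -δ := ⟨-(h 1).re / 2, by linarith, by linarith⟩
  have hopen : IsOpen {p : G × G | (h (p.2⁻¹ * p.1)).re < -δ} :=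
    isOpen_lt (by fun_prop) continuous_const
  have hmem : {p : G × G | (h (p.2⁻¹ * p.1)).re < -δ} ∈ nhds ((1, 1) : G × G) :=
    hopen.mem_nhds (by simpa using hδ')
  rw [nhds_prod_eq, Filter.mem_prod_self_iff] at hmem
  obtain ⟨V, hV, hVs⟩ := hmem
  obtain ⟨U, hUV, hUo, hU1⟩ := mem_nhds_iff.1 hV
  -- A bump function living where the kernel has real part below `-δ`: its quadratic form is at most
  -- `-δ (∫ ψ)² < 0`, contradicting positivity.
  obtain ⟨ψ, hψ0, hψ1, hψ⟩ := exists_continuous_zero_one_of_isClosed (isClosed_compl_iff.2 hUo)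
    (isClosed_singleton (x := (1 : G))) (by simpa using hU1)
  have hψnn : ∀ x, 0 ≤ ψ x := fun x => (hψ x).1
  have hI : ∀ u : C(G, ℝ), Integrable u μ := fun u =>
    u.continuous.integrable_of_hasCompactSupport (HasCompactSupport.of_compactSpace _)
  have hIc : ∀ u : C(G, ℂ), Integrable u μ := fun u =>
    u.continuous.integrable_of_hasCompactSupport (HasCompactSupport.of_compactSpace _)
  have hm : 0 < ∫ x, ψ x ∂μ :=
    ψ.continuous.integral_pos_of_hasCompactSupport_nonneg_nonzero
      (HasCompactSupport.of_compactSpace _) hψnn (x := 1) (by simp [hψ1 rfl])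
  let Ψ : C(G, ℂ) := ⟨fun x => (ψ x : ℂ), by fun_prop⟩
  have hΨ : ∀ x, Ψ x = (ψ x : ℂ) := fun _ => rfl
  have hsupp : ∀ x, x ∉ U → ψ x = 0 := fun x hx => hψ0 hx
  have hin : ∀ x ∈ U, (convC μ Ψ h x).re ≤ -δ * ∫ y, ψ y ∂μ := by
    intro x hx
    rw [convC_apply, conv, ← integral_const_mul]
    have : Integrable (fun y => Ψ y * h (y⁻¹ * x)) μ :=
      hIc (Ψ * translates h x)
    rw [← RCLike.re_eq_complex_re, ← integral_re this]
    refine integral_mono this.re ((hI ψ).const_mul _) fun y => ?_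
    simp only [hΨ, RCLike.re_eq_complex_re, Complex.re_ofReal_mul]
    by_cases hy : y ∈ U
    · have : (h (y⁻¹ * x)).re < -δ := hVs (Set.mk_mem_prod (hUV hx) (hUV hy))
      nlinarith [hψnn y]
    · simp [hsupp y hy]
  have hre := ((ContinuousLinearMap.nonneg_iff_isPositive _).1 hpos).re_inner_nonneg_right
    (ContinuousMap.toLp 2 μ ℂ Ψ)
  have hIm : Integrable (fun x => convC μ Ψ h x * conj (Ψ x)) μ := hIc (convC μ Ψ h * star Ψ)
  rw [convL2_toLp, ContinuousMap.inner_toLp, ← integral_re hIm] at hre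
  have hle : ∫ x, RCLike.re (convC μ Ψ h x * conj (Ψ x)) ∂μ ≤
      ∫ x, (-δ * ∫ y, ψ y ∂μ) * ψ x ∂μ := by
    refine integral_mono hIm.re ((hI ψ).const_mul _) fun x => ?_
    simp only [hΨ, RCLike.re_eq_complex_re, Complex.conj_ofReal, Complex.re_mul_ofReal]
    by_cases hx : x ∈ U
    · exact mul_le_mul_of_nonneg_right (hin x hx) (hψnn x)
    · simp [hsupp x hx]
  rw [integral_const_mul] at hle
  have : 0 < δ * (∫ y, ψ y ∂μ) * ∫ y, ψ y ∂μ := by positivity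
  linarith

end Positivity

/-! ### Polynomial approximation of the square root -/

section SqrtPoly

open Polynomial

/-- The Newton-type iteration `p ↦ p + (X - p²) / 2` approximating the square root from below. -/
def sqrtPoly : ℕ → ℝ[X]
  | 0 => 0
  | n + 1 => sqrtPoly n + C (1 / 2) * (X - sqrtPoly n * sqrtPoly n)

lemma sqrtPoly_succ (n : ℕ) :
    sqrtPoly (n + 1) = sqrtPoly n + C (1 / 2) * (X - sqrtPoly n * sqrtPoly n) := rfl

lemma eval_sqrtPoly_mem {t : ℝ} (h0 : 0 ≤ t) (h1 : t ≤ 1) (n : ℕ) :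
    0 ≤ (sqrtPoly n).eval t ∧ (sqrtPoly n).eval t ≤ √t := by
  have hs0 := Real.sqrt_nonneg t
  have hs1 : √t ≤ 1 := Real.sqrt_le_one.2 h1
  have hsq := Real.mul_self_sqrt h0
  induction n with
  | zero => simp [sqrtPoly]
  | succ n ih =>
    obtain ⟨ih0, ih1⟩ := ih
    simp only [sqrtPoly_succ, eval_add, eval_mul, eval_C, eval_sub, eval_X]
    constructor
    · nlinarith
    -- With `p` the current value, the next error is `(√t - p) * (2 - √t - p) / 2`.
    · nlinarith [mul_nonneg (sub_nonneg.2 ih1) (by linarith : 0 ≤ 2 - √t - (sqrtPoly n).eval t)]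

lemma monotone_eval_sqrtPoly {t : ℝ} (h0 : 0 ≤ t) (h1 : t ≤ 1) :
    Monotone fun n => (sqrtPoly n).eval t := by
  refine monotone_nat_of_le_succ fun n => ?_
  obtain ⟨ih0, ih1⟩ := eval_sqrtPoly_mem h0 h1 n
  have hsq := Real.mul_self_sqrt h0
  simp only [sqrtPoly_succ, eval_add, eval_mul, eval_C, eval_sub, eval_X]
  nlinarith

/-- A real polynomial that is nonnegative on `[0, 1]` is nonnegative at a positive contraction. -/
lemma aeval_nonneg_of_contraction {H : Type*} [NormedAddCommGroup H] [InnerProductSpace ℂ H]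
    [CompleteSpace H] {T : H →L[ℂ] H} (hT : 0 ≤ T) (hT1 : ‖T‖ ≤ 1) {q : ℝ[X]}
    (hq : ∀ t, 0 ≤ t → t ≤ 1 → 0 ≤ q.eval t) : 0 ≤ aeval T q := by
  rw [← cfc_polynomial q T (IsSelfAdjoint.of_nonneg hT)]
  refine cfc_nonneg fun t ht => hq t (spectrum_nonneg_of_nonneg hT ht) ?_
  have h1 := spectrum.norm_le_norm_mul_of_mem ht
  rcases subsingleton_or_nontrivial H with hs | hs
  · exact absurd ht (by simp [spectrum.of_subsingleton])
  · rw [norm_one, mul_one] at h1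
    exact (le_abs_self t).trans (h1.trans hT1)

end SqrtPoly

/-! ### The iteration on functions and its `L²` limit -/

section SqrtIter

open Filter Topology

variable {G : Type*} [Group G] [TopologicalSpace G] [IsTopologicalGroup G] [CompactSpace G]
  [T2Space G] [MeasurableSpace G] [BorelSpace G] (μ : Measure G) [μ.IsHaarMeasure]
  [IsProbabilityMeasure μ]

/-- The iteration `g ↦ g + (f - g ∗ g) / 2` approximating a convolution square root of `f`. -/
def sqrtIter (f : C(G, ℂ)) : ℕ → C(G, ℂ)
  | 0 => 0
  | n + 1 => sqrtIter f n + (1 / 2 : ℂ) • (f - convC μ (sqrtIter f n) (sqrtIter f n))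

lemma sqrtIter_succ (f : C(G, ℂ)) (n : ℕ) : sqrtIter μ f (n + 1) =
    sqrtIter μ f n + (1 / 2 : ℂ) • (f - convC μ (sqrtIter μ f n) (sqrtIter μ f n)) := rfl

/-- The defect is a difference of consecutive terms, so `L²` convergence of the iteration alone
forces it to `0`. -/
lemma sub_convC_sqrtIter (f : C(G, ℂ)) (n : ℕ) :
    f - convC μ (sqrtIter μ f n) (sqrtIter μ f n) =
      (2 : ℂ) • (sqrtIter μ f (n + 1) - sqrtIter μ f n) := by
  rw [sqrtIter_succ, add_sub_cancel_left, smul_smul]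
  norm_num

lemma convL2_sqrtIter (f : C(G, ℂ)) (n : ℕ) :
    convL2 μ (sqrtIter μ f n) = Polynomial.aeval (convL2 μ f) (sqrtPoly n) := by
  induction n with
  | zero => simp [sqrtIter, sqrtPoly, convL2_zero]
  | succ n ih =>
    rw [sqrtIter_succ, sqrtPoly_succ, convL2_add, convL2_smul, convL2_sub, convL2_convC, ih]
    simp only [map_add, map_mul, map_sub, Polynomial.aeval_C, Polynomial.aeval_X]
    rw [← Algebra.smul_def, show (1 / 2 : ℂ) = ((1 / 2 : ℝ) : ℂ) by norm_num]
    rfl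

lemma convC_self_apply_inv (h : C(G, ℂ)) (hh : ∀ x, h x⁻¹ = conj (h x)) (x : G) :
    convC μ h h x⁻¹ = conj (convC μ h h x) := by
  simp only [convC_apply, conv]
  rw [← integral_conj, ← integral_mul_left_eq_self _ x⁻¹]
  refine integral_congr_ae (.of_forall fun y => ?_)
  have h1 := hh (y⁻¹ * x)
  rw [mul_inv_rev, inv_inv] at h1
  simp [h1, hh, mul_comm]

lemma sqrtIter_apply_inv {f : C(G, ℂ)} (hf : ∀ x, f x⁻¹ = conj (f x)) (n : ℕ) (x : G) :
    sqrtIter μ f n x⁻¹ = conj (sqrtIter μ f n x) := by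
  induction n generalizing x with
  | zero => simp [sqrtIter]
  | succ n ih =>
    have h2 : (starRingEnd ℂ) 2 = 2 := Complex.conj_ofNat 2
    simp [sqrtIter_succ, ih, hf, convC_self_apply_inv μ _ ih, h2]

lemma isBiInvariant_convC {K : Subgroup G} {h k : C(G, ℂ)} (hh : IsBiInvariant K h)
    (hk : IsBiInvariant K k) : IsBiInvariant K (convC μ h k) := by
  intro a ha b hb x
  simp only [convC_apply, conv]
  rw [← integral_mul_left_eq_self _ a]
  refine integral_congr_ae (.of_forall fun y => ?_)
  have h1 : h (a * y) = h y := by simpa using hh a ha 1 K.one_mem y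
  have h2 : k (y⁻¹ * x * b) = k (y⁻¹ * x) := by simpa using hk 1 K.one_mem b hb (y⁻¹ * x)
  simp only [h1]
  rw [← h2]
  congr 2
  group

lemma isBiInvariant_sqrtIter {K : Subgroup G} {f : C(G, ℂ)} (hf : IsBiInvariant K f) (n : ℕ) :
    IsBiInvariant K (sqrtIter μ f n) := by
  induction n with
  | zero => intro _ _ _ _ _; simp [sqrtIter]
  | succ n ih =>
    intro a ha b hb x
    simp [sqrtIter_succ, ih a ha b hb x, hf a ha b hb x,
      isBiInvariant_convC μ ih ih a ha b hb x]

/-- At the identity the second factor is `h y⁻¹ = conj (h y)`. This turns bounds on values at `1`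
into `L²` bounds. -/
lemma norm_toLp_sq_of_hermitian {h : C(G, ℂ)} (hh : ∀ x, h x⁻¹ = conj (h x)) :
    ‖ContinuousMap.toLp 2 μ ℂ h‖ ^ 2 = (convC μ h h 1).re := by
  rw [← inner_self_eq_norm_sq (𝕜 := ℂ), ContinuousMap.inner_toLp, convC_apply, conv]
  simp [hh]

lemma re_apply_one_nonneg_of_aeval {f : C(G, ℂ)} (hpos : 0 ≤ convL2 μ f) (hf1 : ‖f‖ ≤ 1)
    {h : C(G, ℂ)} {q : Polynomial ℝ}
    (hh : convL2 μ h = Polynomial.aeval (convL2 μ f) q)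
    (hq : ∀ t, 0 ≤ t → t ≤ 1 → 0 ≤ q.eval t) : 0 ≤ (h 1).re :=
  re_apply_one_nonneg_of_convL2_nonneg μ h
    (hh ▸ aeval_nonneg_of_contraction hpos ((norm_convL2_le μ f).trans hf1) hq)

lemma convL2_sqrtIter_nonneg {f : C(G, ℂ)} (hpos : 0 ≤ convL2 μ f) (hf1 : ‖f‖ ≤ 1) (n : ℕ) :
    0 ≤ convL2 μ (sqrtIter μ f n) :=
  convL2_sqrtIter μ f n ▸ aeval_nonneg_of_contraction hpos ((norm_convL2_le μ f).trans hf1)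
    fun _ h0 h1 => (eval_sqrtPoly_mem h0 h1 n).1

lemma re_convC_sqrtIter_le {f : C(G, ℂ)} (hpos : 0 ≤ convL2 μ f) (hf1 : ‖f‖ ≤ 1) (n : ℕ) :
    (convC μ (sqrtIter μ f n) (sqrtIter μ f n) 1).re ≤ (f 1).re := by
  have := re_apply_one_nonneg_of_aeval μ hpos hf1
    (h := f - convC μ (sqrtIter μ f n) (sqrtIter μ f n))
    (q := .X - sqrtPoly n * sqrtPoly n) (by simp [convL2_sub, convL2_convC, convL2_sqrtIter])
    fun t h0 h1 => by
      obtain ⟨a, b⟩ := eval_sqrtPoly_mem h0 h1 n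
      have := Real.mul_self_sqrt h0
      simp only [Polynomial.eval_sub, Polynomial.eval_X, Polynomial.eval_mul]
      nlinarith
  simpa using this

lemma norm_toLp_sqrtIter_sub_sq_le {f : C(G, ℂ)} (hpos : 0 ≤ convL2 μ f) (hf1 : ‖f‖ ≤ 1)
    (hf : ∀ x, f x⁻¹ = conj (f x)) {n m : ℕ} (hnm : n ≤ m) :
    ‖ContinuousMap.toLp 2 μ ℂ (sqrtIter μ f m - sqrtIter μ f n)‖ ^ 2 ≤
      (convC μ (sqrtIter μ f m) (sqrtIter μ f m) 1).re -
        (convC μ (sqrtIter μ f n) (sqrtIter μ f n) 1).re := by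
  rw [norm_toLp_sq_of_hermitian μ fun x => by simp [sqrtIter_apply_inv μ hf]]
  have := re_apply_one_nonneg_of_aeval μ hpos hf1
    (h := convC μ (sqrtIter μ f m) (sqrtIter μ f m) - convC μ (sqrtIter μ f n) (sqrtIter μ f n) -
      convC μ (sqrtIter μ f m - sqrtIter μ f n) (sqrtIter μ f m - sqrtIter μ f n))
    (q := sqrtPoly m * sqrtPoly m - sqrtPoly n * sqrtPoly n -
      (sqrtPoly m - sqrtPoly n) * (sqrtPoly m - sqrtPoly n))
    (by simp only [convL2_sub, convL2_convC, convL2_sqrtIter, map_sub, map_mul])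
    fun t h0 h1 => by
      obtain ⟨a, b⟩ := eval_sqrtPoly_mem h0 h1 n
      have := monotone_eval_sqrtPoly h0 h1 hnm
      simp only [Polynomial.eval_sub, Polynomial.eval_mul]
      -- For values `r ≤ s` of the two polynomials, `s² - r² - (s - r)² = 2 r (s - r)`.
      nlinarith [mul_nonneg a (sub_nonneg.2 this)]
  simp only [ContinuousMap.sub_apply, Complex.sub_re] at this
  linarith

lemma cauchySeq_toLp_sqrtIter {f : C(G, ℂ)} (hpos : 0 ≤ convL2 μ f) (hf1 : ‖f‖ ≤ 1)
    (hf : ∀ x, f x⁻¹ = conj (f x)) :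
    CauchySeq fun n => ContinuousMap.toLp 2 μ ℂ (sqrtIter μ f n) := by
  set a : ℕ → ℝ := fun n => (convC μ (sqrtIter μ f n) (sqrtIter μ f n) 1).re with ha
  have hle : ∀ n m, n ≤ m →
      ‖ContinuousMap.toLp 2 μ ℂ (sqrtIter μ f m - sqrtIter μ f n)‖ ^ 2 ≤ a m - a n :=
    fun n m hnm => norm_toLp_sqrtIter_sub_sq_le μ hpos hf1 hf hnm
  have hmono : Monotone a := fun n m hnm => by
    have := (sq_nonneg _).trans (hle n m hnm)
    linarith
  have hbdd : BddAbove (Set.range a) :=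
    ⟨(f 1).re, by rintro _ ⟨n, rfl⟩; exact re_convC_sqrtIter_le μ hpos hf1 n⟩
  have hlim := tendsto_atTop_ciSup hmono hbdd
  refine cauchySeq_of_le_tendsto_0' (fun n => √((⨆ i, a i) - a n)) (fun n m hnm => ?_) ?_
  · rw [dist_comm, dist_eq_norm, ← map_sub]
    refine Real.le_sqrt_of_sq_le ((hle n m hnm).trans ?_)
    linarith [le_ciSup hbdd m]
  · have := ((tendsto_const_nhds (x := ⨆ i, a i)).sub hlim).sqrt
    simpa using this

/-- An `L²` limit of continuous bi-invariant functions has a bi-invariant representative. -/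
lemma exists_isBiInvariant_rep {K : Subgroup G} {u : ℕ → C(G, ℂ)}
    (hu : ∀ n, IsBiInvariant K (u n)) {A : Lp ℂ 2 μ}
    (hA : Tendsto (fun n => ContinuousMap.toLp 2 μ ℂ (u n)) atTop (𝓝 A)) :
    ∃ g : G → ℂ, IsBiInvariant K g ∧ MemLp g 2 μ ∧
      Tendsto (fun n => (eLpNorm (g - ⇑(u n)) 2 μ).toReal) atTop (𝓝 0) := by
  obtain ⟨ns, -, hns⟩ := (tendstoInMeasure_of_tendsto_Lp hA).exists_seq_tendsto_ae
  -- Defined at every point, with a junk value where there is no limit. Points related by `K` carry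
  -- the same sequence, so bi-invariance is exact and not merely almost everywhere.
  let g : G → ℂ := fun x => limUnder atTop fun k => u (ns k) x
  have hae : g =ᵐ[μ] A := by
    have hall : ∀ᵐ x ∂μ, ∀ n, (ContinuousMap.toLp 2 μ ℂ (u n) : Lp ℂ 2 μ) x = u n x :=
      ae_all_iff.2 fun n => ContinuousMap.coeFn_toLp μ (u n)
    filter_upwards [hns, hall] with x hx hx'
    simp only [hx'] at hx
    exact hx.limUnder_eq
  refine ⟨g, fun a ha b hb x => ?_, (memLp_congr_ae hae).2 (Lp.memLp A), ?_⟩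
  · simp only [g, hu _ a ha b hb x]
  · have h0 := (tendsto_const_nhds (x := A)).sub hA |>.norm
    rw [sub_self, norm_zero] at h0
    refine h0.congr fun n => ?_
    rw [Lp.norm_def]
    congr 1
    refine eLpNorm_congr_ae ?_
    filter_upwards [hae, Lp.coeFn_sub A (ContinuousMap.toLp 2 μ ℂ (u n)),
      ContinuousMap.coeFn_toLp (p := 2) (𝕜 := ℂ) μ (u n)] with x h1 h2 h3
    rw [h2, Pi.sub_apply, Pi.sub_apply, h1, h3]

end SqrtIter

/-! ### Passage to the limit -/

section Limit

open Filter Topology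

lemma norm_integral_mul_le_of_memLp_two {α : Type*} [MeasurableSpace α] {μ : Measure α}
    {a b : α → ℂ} (ha : MemLp a 2 μ) (hb : MemLp b 2 μ) :
    ‖∫ x, a x * b x ∂μ‖ ≤ (eLpNorm a 2 μ).toReal * (eLpNorm b 2 μ).toReal := by
  have h := norm_inner_le_norm (𝕜 := ℂ) (ha.star.toLp (star a)) (hb.toLp b)
  rw [Lp.norm_toLp, Lp.norm_toLp, eLpNorm_star, L2.inner_def] at h
  refine (congrArg norm (integral_congr_ae ?_)).trans_le h
  filter_upwards [ha.star.coeFn_toLp, hb.coeFn_toLp] with x h1 h2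
  rw [h1, h2]
  simp [mul_comm]

variable {G : Type*} [Group G] [TopologicalSpace G] [IsTopologicalGroup G] [CompactSpace G]
  [T2Space G] [MeasurableSpace G] [BorelSpace G] (μ : Measure G) [μ.IsHaarMeasure]
  [IsProbabilityMeasure μ]

lemma convExistsAt_of_memLp_two {a b : G → ℂ} (ha : MemLp a 2 μ) (hb : MemLp b 2 μ) (x : G) :
    ConvExistsAt μ a b x :=
  ha.integrable_mul (hb.comp_measurePreserving (measurePreserving_inv_mul_const μ x))

lemma norm_conv_le_of_memLp_two {a b : G → ℂ} (ha : MemLp a 2 μ) (hb : MemLp b 2 μ) (x : G) :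
    ‖conv μ a b x‖ ≤ (eLpNorm a 2 μ).toReal * (eLpNorm b 2 μ).toReal := by
  have hx := measurePreserving_inv_mul_const μ x
  have := norm_integral_mul_le_of_memLp_two ha (hb.comp_measurePreserving hx)
  rwa [eLpNorm_comp_measurePreserving hb.1 hx] at this

/-- Expanding `b = a - (a - b)` leaves three convolutions with a factor `a - b`, each bounded by
Cauchy-Schwarz uniformly in `x`. -/
lemma norm_conv_self_sub_le {a b : G → ℂ} (ha : MemLp a 2 μ) (hb : MemLp b 2 μ) (x : G) :
    ‖conv μ a a x - conv μ b b x‖ ≤ (eLpNorm (a - b) 2 μ).toReal *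
      (2 * (eLpNorm a 2 μ).toReal + (eLpNorm (a - b) 2 μ).toReal) := by
  have hab := ha.sub hb
  have h1 := norm_conv_le_of_memLp_two μ hab ha x
  have h2 := norm_conv_le_of_memLp_two μ ha hab x
  have h3 := norm_conv_le_of_memLp_two μ hab hab x
  have key : conv μ a a x - conv μ b b x =
      conv μ (a - b) a x + conv μ a (a - b) x - conv μ (a - b) (a - b) x := by
    simp only [conv]
    rw [← integral_sub, ← integral_add, ← integral_sub]
    · refine integral_congr_ae (.of_forall fun y => ?_)
      simp only [Pi.sub_apply]
      ring
    · exact (convExistsAt_of_memLp_two μ hab ha x).add (convExistsAt_of_memLp_two μ ha hab x)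
    · exact convExistsAt_of_memLp_two μ hab hab x
    · exact convExistsAt_of_memLp_two μ hab ha x
    · exact convExistsAt_of_memLp_two μ ha hab x
    · exact convExistsAt_of_memLp_two μ ha ha x
    · exact convExistsAt_of_memLp_two μ hb hb x
  rw [key]
  refine (norm_sub_le _ _).trans ((add_le_add_left (norm_add_le _ _) _).trans ?_)
  linarith

/-- `u n ∗ u n` converges uniformly to `g ∗ g` if `u n` converges to `g` in `L²`. -/
lemma tendstoUniformly_convC_self {g : G → ℂ} (hg : MemLp g 2 μ) {u : ℕ → C(G, ℂ)}
    (hu : Tendsto (fun n => (eLpNorm (g - ⇑(u n)) 2 μ).toReal) atTop (𝓝 0)) :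
    TendstoUniformly (fun n => ⇑(convC μ (u n) (u n))) (conv μ g g) atTop := by
  have h0 := hu.mul (hu.const_add (2 * (eLpNorm g 2 μ).toReal))
  rw [zero_mul] at h0
  rw [Metric.tendstoUniformly_iff]
  intro ε hε
  filter_upwards [h0.eventually_lt_const hε] with n hn x
  rw [dist_eq_norm, convC_apply]
  exact (norm_conv_self_sub_le μ hg ((u n).memLp μ ℂ) x).trans_lt hn

/-- If convolution by each `u n` is a positive operator and `u n` converges to `g` in `L²`, then
`g` is integrally positive definite. -/
lemma isIntegrallyPosDef_of_tendsto {g : G → ℂ} (hg : MemLp g 2 μ) {u : ℕ → C(G, ℂ)}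
    (hpos : ∀ n, 0 ≤ convL2 μ (u n))
    (hu : Tendsto (fun n => (eLpNorm (g - ⇑(u n)) 2 μ).toReal) atTop (𝓝 0)) :
    IsIntegrallyPosDef μ g := by
  intro φ hφ _
  have hφm : MemLp φ 2 μ := (⟨φ, hφ⟩ : C(G, ℂ)).memLp μ ℂ
  have hnn : ∀ n, 0 ≤ ∫ y, ∫ x, u n (y⁻¹ * x) * φ x * conj (φ y) ∂μ ∂μ := by
    intro n
    -- The operator's quadratic form conjugates the other variable, so it is tested on `conj φ`.
    let Φ : C(G, ℂ) := ⟨fun x => conj (φ x), by fun_prop⟩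
    have h := ((ContinuousLinearMap.nonneg_iff_isPositive _).1 (hpos n)).inner_nonneg_right
      (ContinuousMap.toLp 2 μ ℂ Φ)
    rw [inner_toLp_convL2_toLp, integral_integral_swap_of_continuous μ (by
      simp only [Function.uncurry_def]; fun_prop)] at h
    convert h using 5 with y x
    simp only [Φ, ContinuousMap.coe_mk, Complex.conj_conj]
    ring
  have hcomp : ∀ (a : G → ℂ) (y : G), MemLp a 2 μ → MemLp (fun x => a (y⁻¹ * x)) 2 μ ∧
      eLpNorm (fun x => a (y⁻¹ * x)) 2 μ = eLpNorm a 2 μ := fun a y ha =>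
    ⟨ha.comp_measurePreserving (measurePreserving_mul_left μ y⁻¹),
      eLpNorm_comp_measurePreserving ha.1 (measurePreserving_mul_left μ y⁻¹)⟩
  have hpt : ∀ y, Tendsto (fun n => ∫ x, u n (y⁻¹ * x) * φ x ∂μ) atTop
      (𝓝 (∫ x, g (y⁻¹ * x) * φ x ∂μ)) := by
    intro y
    rw [tendsto_iff_norm_sub_tendsto_zero]
    refine squeeze_zero (fun _ => norm_nonneg _) (fun n => ?_)
      (by simpa using hu.mul_const (eLpNorm φ 2 μ).toReal)
    have hgu := hg.sub ((u n).memLp μ ℂ)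
    have hi1 : Integrable (fun x => g (y⁻¹ * x) * φ x) μ := (hcomp g y hg).1.integrable_mul hφm
    have hi2 : Integrable (fun x => u n (y⁻¹ * x) * φ x) μ :=
      (hcomp (u n) y ((u n).memLp μ ℂ)).1.integrable_mul hφm
    rw [norm_sub_rev, ← integral_sub hi1 hi2]
    have := norm_integral_mul_le_of_memLp_two (hcomp _ y hgu).1 hφm
    rw [(hcomp _ y hgu).2] at this
    simpa only [Pi.sub_apply, sub_mul] using this
  have hmeas : ∀ n, Continuous fun y => ∫ x, u n (y⁻¹ * x) * φ x ∂μ := by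
    intro n
    -- The integral is `(φ ∗ v) y`, hence continuous in `y`.
    let v : C(G, ℂ) := ⟨fun x => u n x⁻¹, by fun_prop⟩
    refine (convC μ ⟨φ, hφ⟩ v).continuous.congr fun y => ?_
    rw [convC_apply, conv]
    simp [v, mul_comm]
  have hlim : Tendsto (fun n => ∫ y, (∫ x, u n (y⁻¹ * x) * φ x ∂μ) * conj (φ y) ∂μ) atTop
      (𝓝 (∫ y, (∫ x, g (y⁻¹ * x) * φ x ∂μ) * conj (φ y) ∂μ)) := by
    refine tendsto_integral_filter_of_dominated_convergence
      -- The `+ 1` covers `‖g - u n‖₂`, which is eventually below `1`.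
      (fun y => ((eLpNorm g 2 μ).toReal + 1) * (eLpNorm φ 2 μ).toReal * ‖φ y‖)
      (.of_forall fun n => ((hmeas n).mul (by fun_prop)).aestronglyMeasurable) ?_
      ((hφm.integrable (by norm_num)).norm.const_mul _)
      (.of_forall fun y => (hpt y).mul_const _)
    filter_upwards [hu.eventually_lt_const one_pos] with n hn
    refine .of_forall fun y => ?_
    rw [norm_mul, RCLike.norm_conj]
    refine mul_le_mul_of_nonneg_right ?_ (norm_nonneg _)
    have hum : MemLp (u n) 2 μ := (u n).memLp μ ℂ
    have h1 := norm_integral_mul_le_of_memLp_two (hcomp _ y hum).1 hφm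
    rw [(hcomp _ y hum).2] at h1
    refine h1.trans (mul_le_mul_of_nonneg_right ?_ ENNReal.toReal_nonneg)
    have h2 : eLpNorm (u n) 2 μ ≤ eLpNorm g 2 μ + eLpNorm (g - ⇑(u n)) 2 μ := by
      have := eLpNorm_sub_le hg.1 (hg.sub hum).1 (p := 2) one_le_two
      rwa [sub_sub_cancel] at this
    have h3 := ENNReal.toReal_mono (ENNReal.add_ne_top.2 ⟨hg.2.ne, (hg.sub hum).2.ne⟩) h2
    rw [ENNReal.toReal_add hg.2.ne (hg.sub hum).2.ne] at h3
    linarith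
  simp only [integral_mul_const] at hnn ⊢
  exact ge_of_tendsto' hlim hnn

/-- A continuous function of norm at most one, right convolution by which is a positive operator,
has a convolution square root in `L²` that inherits bi-invariance. -/
lemma exists_conv_self_eq {K : Subgroup G} {f : C(G, ℂ)} (hpos : 0 ≤ convL2 μ f)
    (hf1 : ‖f‖ ≤ 1) (hf : ∀ x, f x⁻¹ = conj (f x)) (hK : IsBiInvariant K f) :
    ∃ g : G → ℂ, MemLp g 2 μ ∧ IsIntegrallyPosDef μ g ∧ IsBiInvariant K g ∧
      ∀ x, f x = conv μ g g x := by
  have hcs := cauchySeq_toLp_sqrtIter μ hpos hf1 hf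
  obtain ⟨A, hA⟩ := cauchySeq_tendsto_of_complete hcs
  obtain ⟨g, hgK, hg, hlim⟩ := exists_isBiInvariant_rep μ (isBiInvariant_sqrtIter μ hK) hA
  refine ⟨g, hg, isIntegrallyPosDef_of_tendsto μ hg (convL2_sqrtIter_nonneg μ hpos hf1) hlim,
    hgK, ?_⟩
  have hunif := tendstoUniformly_convC_self μ hg hlim
  let F : C(G, ℂ) := ⟨conv μ g g, hunif.continuous
    (Frequently.of_forall fun n => (convC μ (sqrtIter μ f n) (sqrtIter μ f n)).continuous)⟩
  have hF : Tendsto (fun n => convC μ (sqrtIter μ f n) (sqrtIter μ f n)) atTop (𝓝 F) :=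
    ContinuousMap.tendsto_iff_tendstoUniformly.2 hunif
  have hF' := ((ContinuousMap.toLp 2 μ ℂ).continuous.tendsto (f - F)).comp (hF.const_sub f)
  have h0 : Tendsto (fun n => ContinuousMap.toLp 2 μ ℂ
      (f - convC μ (sqrtIter μ f n) (sqrtIter μ f n))) atTop (𝓝 0) := by
    simp only [sub_convC_sqrtIter, map_smul, map_sub]
    simpa using ((hA.comp (tendsto_add_atTop_nat 1)).sub hA).const_smul (2 : ℂ)
  have h1 : ContinuousMap.toLp 2 μ ℂ (f - F) = 0 := tendsto_nhds_unique hF' h0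
  have h2 : f - F = 0 := ContinuousMap.toLp_injective (𝕜 := ℂ) (p := 2) μ (by rw [h1, map_zero])
  intro x
  rw [sub_eq_zero.1 h2]
  rfl

end Limit

end

lemma IsPosDef.const_mul {G : Type*} [Group G] {f : G → ℂ} (hf : IsPosDef f) {c : ℂ}
    (hc : 0 ≤ c) : IsPosDef fun x => c * f x := by
  intro n a x
  have := mul_nonneg hc (hf n a x)
  simp only [Finset.mul_sum] at this
  convert this using 3
  ring

end GelfandRoot

/-! ### The main theorem, by rescaling -/

theorem mainTheorem3 {G : Type*} [Group G] [TopologicalSpace G] [IsTopologicalGroup G]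
    [CompactSpace G] [T2Space G] [MeasurableSpace G] [BorelSpace G]
    (μ : Measure G) [μ.IsHaarMeasure] [μ.Regular] [IsProbabilityMeasure μ]
    (K : Subgroup G) (hGK : GelfandRoot.IsGelfandPair μ K)
    (f : G → ℝ) (hf_cont : Continuous f)
    (hf_pd : GelfandRoot.IsPosDef (fun x => (f x : ℂ)))
    (hf_inv : GelfandRoot.IsBiInvariant K f) :
    ∃ g : G → ℂ, MemLp g 2 μ ∧ GelfandRoot.IsIntegrallyPosDef μ g ∧
      GelfandRoot.IsBiInvariant K g ∧
      ∀ x : G, GelfandRoot.ConvExistsAt μ g g x ∧ (f x : ℂ) = GelfandRoot.conv μ g g x := by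
  let F : C(G, ℂ) := ⟨fun x => (f x : ℂ), by fun_prop⟩
  have hc : 0 < ‖F‖ + 1 := by positivity
  -- Adding `1` keeps `c` invertible when `f = 0`. The root of `c⁻¹ f` is multiplied by `√c` at the
  -- end.
  set c : ℝ := ‖F‖ + 1 with hc_def
  have hcC : (0 : ℂ) ≤ ((c⁻¹ : ℝ) : ℂ) := Complex.zero_le_real.2 (inv_nonneg.2 hc.le)
  let F₁ : C(G, ℂ) := ((c⁻¹ : ℝ) : ℂ) • F
  have hF₁ : ∀ x, F₁ x = ((c⁻¹ : ℝ) : ℂ) * (f x : ℂ) := fun _ => rfl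
  have hsymm : ∀ x, F₁ x⁻¹ = conj (F₁ x) := fun x => by
    rw [hF₁, hF₁, hf_pd.apply_inv_of_real, map_mul, Complex.conj_ofReal, Complex.conj_ofReal]
  have hnorm : ‖F₁‖ ≤ 1 := by
    rw [norm_smul, Complex.norm_real, Real.norm_of_nonneg (inv_nonneg.2 hc.le),
      inv_mul_le_one₀ hc]
    linarith
  have hpos := GelfandRoot.convL2_nonneg_of_isPosDef μ F₁ (hf_pd.const_mul hcC) hsymm
  obtain ⟨g, hg, hgpd, hgK, hconv⟩ := GelfandRoot.exists_conv_self_eq μ (K := K) hpos hnorm hsymm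
    fun a ha b hb x => by rw [hF₁, hF₁, hf_inv a ha b hb x]
  have hs : ((√c : ℝ) : ℂ) * ((√c : ℝ) : ℂ) = c := by
    rw [← Complex.ofReal_mul, Real.mul_self_sqrt hc.le]
  have hg' : MemLp (fun x => ((√c : ℝ) : ℂ) * g x) 2 μ := hg.const_mul _
  refine ⟨fun x => ((√c : ℝ) : ℂ) * g x, hg', fun φ hφ hφs => ?_, fun a ha b hb x => ?_,
    fun x => ⟨GelfandRoot.convExistsAt_of_memLp_two μ hg' hg' x, ?_⟩⟩
  · have := mul_nonneg (Complex.zero_le_real.2 (Real.sqrt_nonneg c)) (hgpd φ hφ hφs)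
    rw [← integral_const_mul] at this
    simp only [← integral_const_mul] at this
    simpa only [mul_assoc] using this
  · simp only [hgK a ha b hb x]
  · have h1 : GelfandRoot.conv μ (fun x => ((√c : ℝ) : ℂ) * g x)
        (fun x => ((√c : ℝ) : ℂ) * g x) x = c * GelfandRoot.conv μ g g x := by
      simp only [GelfandRoot.conv]
      rw [← integral_const_mul, ← hs]
      refine integral_congr_ae (.of_forall fun y => ?_)
      simp only
      ring
    rw [h1, ← hconv, hF₁, ← mul_assoc, ← Complex.ofReal_mul, mul_inv_cancel₀ hc.ne',
      Complex.ofReal_one, one_mul]
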